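/- Let $\ell^2$ be the real Hilbert space of square-summable real sequences with inner product $\langle\cdot,\cdot\rangle$. A function $K\colon X\times X\to\mathbb{C}$ is called a positive definite kernel on $X$ if $\sum_{i,j=1}^m c_i\overline{c_j}K(x_i,x_j)\ge 0$ for all $m\in\mathbb{N}$, $x_1,\dots,x_m\in X$ and $c\in\mathbb{C}^m$; it is called strictly positive definite if moreover this inequality is strict whenever $x_1,\dots,x_m$ are distinct and $c\ne 0$. Throughout, $\langle x,y\rangle^0=1$. 1. Let $K(x,y)=\kappa(\langle x,y\rangle)$, with $\kappa\colon\mathbb{R}\to\mathbb{C}$, be a continuous positive definite kernel on $\ell^2$. Then there are real numbers $a_n\ge 0$ $(n\ge 0)$ such that $(a_nt^n)_{n\ge 0}\in\ell^1$ for all $t\in\mathbb{R}$ and $$K(x,y)=\sum_{n=0}^\infty a_n\langle x,y\rangle^n\qquad\text{for all }x,y\in\ell^2.$$ 2. Conversely, if $a_n\ge 0$ for all $n\ge 0$ and $(a_nt^n)_{n\ge 0}\in\ell^1$ for all $t\in\mathbb{R}$, then $K(x,y)=\sum_{n=0}^\infty a_n\langle x,y\rangle^n$ is well defined and is a continuous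 positive definite kernel on $\ell^2$ that depends only on $\langle x,y\rangle$. 3. Let $K$ be a positive definite kernel on $\ell^2$ of the form $K(x,y)=\sum_{n=0}^\infty a_n\langle x,y\rangle^n$, with $a_n\in\mathbb{R}$ and the series absolutely convergent for all $x,y\in\ell^2$. Then $K$ is strictly positive definite on $\ell^2$ if and only if $a_0>0$ and $a_n>0$ holds for infinitely many even and infinitely many odd indices $n$. The restriction of $K$ to $\ell^2\setminus\{0\}$ is strictly positive definite if and only if $a_n>0$ holds for infinitely many even and infinitely many odd indices $n$. -/

import Mathlib

/-- The real Hilbert space `ℓ²` of square-summable real sequences. -/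
abbrev EllTwo : Type := lp (fun _ : ℕ => ℝ) 2

open scoped ComplexOrder in
/-- Positive definite kernels: `∑ c_i conj(c_j) K(x_i, x_j) ≥ 0` for all finite families.
For complex numbers, `0 ≤ z` means that `z` is real and nonnegative. -/
def IsPosDefKernel {X : Type*} (K : X → X → ℂ) : Prop :=
  ∀ (m : ℕ) (x : Fin m → X) (c : Fin m → ℂ),
    0 ≤ ∑ i, ∑ j, c i * (starRingEnd ℂ) (c j) * K (x i) (x j)

open scoped ComplexOrder in
/-- Strictly positive definite kernels: positive definite, with strict inequality whenever the
points are distinct and the coefficient vector is nonzero. -/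
def IsStrictlyPosDefKernel {X : Type*} (K : X → X → ℂ) : Prop :=
  IsPosDefKernel K ∧
    ∀ (m : ℕ) (x : Fin m → X) (c : Fin m → ℂ), Function.Injective x → c ≠ 0 →
      0 < ∑ i, ∑ j, c i * (starRingEnd ℂ) (c j) * K (x i) (x j)

/-- `K` depends on the dot product only: `K(x, y) = κ(⟨x, y⟩)`. -/
def IsDotProductFunction (K : EllTwo → EllTwo → ℂ) : Prop :=
  ∃ κ : ℝ → ℂ, ∀ x y : EllTwo, K x y = κ (inner ℝ x y)

/-- `K(x, y) = ∑ a_n ⟨x, y⟩ ^ n`, the series converging (absolutely) for all `x` and `y`;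
here `⟨x, y⟩ ^ 0 = 1`. -/
def HasDotProductExpansion (K : EllTwo → EllTwo → ℂ) (a : ℕ → ℝ) : Prop :=
  ∀ x y : EllTwo, HasSum (fun n : ℕ => ((a n * (inner ℝ x y) ^ n : ℝ) : ℂ)) (K x y)

/-! Since any positive semidefinite matrix is a Gram matrix in an infinite-dimensional space, a
kernel `f ⟪x, y⟫` is positive definite exactly when `f`, applied entrywise, preserves positive
semidefiniteness. By a theorem of Schoenberg and Rudin these `f` are the everywhere convergent
power series with nonnegative coefficients: forward differences of such an `f` again preserve
positive semidefiniteness, so `f` is continuous, its dyadic difference quotients converge, and all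
its derivatives are preservers as well. A preserver satisfies `|f t| ≤ f |t|` and is monotone on
the nonnegative reals, which bounds the Taylor remainder by `f (3 * |t|) / 2 ^ n`.

If the quadratic form `∑ c i * c j * f ⟪x i, x j⟫` vanishes, then so does the contribution of every
`n` with `0 < a n`, whence `∑ i, ⟪x j, x i⟫ ^ n * c i = 0` for all `j`. Choosing `j` with `c j ≠ 0`
and `‖x j‖` maximal and letting `n → ∞` along even and along odd exponents forces `c j = 0`.
Conversely, symmetric points on a line and suitable weights annihilate all moments of one parity
together with any finite set of the other, so no parity class of `{n | 0 < a n}` is finite.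
-/

section

open Filter Topology Set Matrix fwdDiff

/-! ### Entrywise preservers of positive semidefiniteness -/

/-- `f` preserves positive semidefiniteness when applied entrywise to finite real matrices of any
size. -/
def PreservesPosSemidef (f : ℝ → ℝ) : Prop :=
  ∀ (ι : Type) [Finite ι] (A : Matrix ι ι ℝ), A.PosSemidef → (A.map f).PosSemidef

theorem posSemidef_of_const (ι : Type*) [Finite ι] {t : ℝ} (ht : 0 ≤ t) :
    (of fun _ _ : ι => t).PosSemidef := by
  convert (posSemidef_vecMulVec_self_star (1 : ι → ℝ)).smul ht
  ext
  simp

theorem posSemidef_two_abs (t : ℝ) : (!![|t|, t; t, |t|]).PosSemidef := by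
  convert (posSemidef_vecMulVec_self_star ![1, (SignType.sign t : ℝ)]).smul (abs_nonneg t)
  ext i j
  rcases lt_trichotomy t 0 with ht | rfl | ht <;> fin_cases i <;> fin_cases j <;>
    simp [abs_of_neg, abs_of_pos, *]

namespace PreservesPosSemidef

variable {f g : ℝ → ℝ}

protected theorem zero : PreservesPosSemidef 0 :=
  fun _ _ _ _ => PosSemidef.zero

protected theorem add (hf : PreservesPosSemidef f) (hg : PreservesPosSemidef g) :
    PreservesPosSemidef (f + g) :=
  fun ι _ A hA => (hf ι A hA).add (hg ι A hA)

protected theorem const_mul (hf : PreservesPosSemidef f) {c : ℝ} (hc : 0 ≤ c) :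
    PreservesPosSemidef fun t => c * f t :=
  fun ι _ A hA => (hf ι A hA).smul hc

theorem of_tendsto {F : ℕ → ℝ → ℝ} (hF : ∀ n, PreservesPosSemidef (F n))
    (hlim : ∀ t, Tendsto (F · t) atTop (𝓝 (f t))) : PreservesPosSemidef f := by
  intro ι _ A hA
  have := Fintype.ofFinite ι
  refine .of_dotProduct_mulVec_nonneg ?_ fun c => ?_
  · exact hA.isHermitian.map _ fun _ => rfl
  · have hcont : Continuous fun B : Matrix ι ι ℝ => star c ⬝ᵥ B *ᵥ c := by fun_prop
    have hmap : Tendsto (fun n => A.map (F n)) atTop (𝓝 (A.map f)) :=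
      tendsto_pi_nhds.2 fun i => tendsto_pi_nhds.2 fun j => hlim (A i j)
    exact ge_of_tendsto' ((hcont.tendsto _).comp hmap) fun n =>
      (hF n ι A hA).dotProduct_mulVec_nonneg c

protected theorem pow (n : ℕ) : PreservesPosSemidef (· ^ n) := by
  intro ι _ A hA
  induction n with
  | zero => simpa [Matrix.map] using posSemidef_of_const ι zero_le_one
  | succ n ih =>
    have hmap : A.map (· ^ (n + 1)) = A.map (· ^ n) ⊙ A := by
      ext
      exact pow_succ _ _
    rw [hmap]
    exact ih.hadamard hA

theorem of_hasSum {a : ℕ → ℝ} (ha : ∀ n, 0 ≤ a n)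
    (hf : ∀ t, HasSum (fun n => a n * t ^ n) (f t)) : PreservesPosSemidef f := by
  refine of_tendsto (F := fun n => ∑ k ∈ Finset.range n, fun t => a k * t ^ k) (fun n => ?_)
    fun t => by simpa only [Finset.sum_apply] using (hf t).tendsto_sum_nat
  exact Finset.sum_induction _ _ (fun _ _ => .add) .zero fun k _ =>
    (PreservesPosSemidef.pow k).const_mul (ha k)

theorem apply_nonneg (hf : PreservesPosSemidef f) {t : ℝ} (ht : 0 ≤ t) : 0 ≤ f t :=
  (hf Unit _ (posSemidef_of_const Unit ht)).diag_nonneg (i := ())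

theorem abs_apply_le (hf : PreservesPosSemidef f) (t : ℝ) : |f t| ≤ f |t| := by
  have hdet : 0 ≤ f |t| * f |t| - f t * f t := by
    simpa [det_fin_two] using (hf (Fin 2) _ (posSemidef_two_abs t)).det_nonneg
  exact abs_le_of_sq_le_sq (by linarith) (hf.apply_nonneg (abs_nonneg t))

protected theorem fwdDiff (hf : PreservesPosSemidef f) {h : ℝ} (hh : 0 ≤ h) :
    PreservesPosSemidef (Δ_[h] f) := by
  -- Apply `f` to the block matrix `[A, A; A, A + h]` and compress by the block column `(-1, 1)`.
  intro ι _ A hA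
  classical
  have := Fintype.ofFinite ι
  have hblock : (fromBlocks A A A (A + of fun _ _ => h)).PosSemidef := by
    convert (hA.submatrix (Sum.elim id id)).add
      ((posSemidef_vecMulVec_self_star (Sum.elim 0 1 : ι ⊕ ι → ℝ)).smul hh)
    ext (i | i) (j | j) <;> simp [vecMulVec_apply]
  convert (hf _ _ hblock).conjTranspose_mul_mul_same (fromRows (-1) 1 : Matrix (ι ⊕ ι) ι ℝ)
  rw [conjTranspose_fromRows_eq_fromCols_conjTranspose, fromBlocks_map, fromCols_mul_fromBlocks,
    fromCols_mul_fromRows]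
  ext
  simp [fwdDiff, sub_eq_neg_add]

protected theorem monotoneOn (hf : PreservesPosSemidef f) : MonotoneOn f (Ici 0) := by
  intro s hs t _ hst
  simpa [fwdDiff] using (hf.fwdDiff (sub_nonneg.2 hst)).apply_nonneg hs

theorem abs_apply_le_of_abs_le (hf : PreservesPosSemidef f) {t T : ℝ} (ht : |t| ≤ T) :
    |f t| ≤ f T :=
  (hf.abs_apply_le t).trans (hf.monotoneOn (abs_nonneg t) ((abs_nonneg t).trans ht) ht)

end PreservesPosSemidef

/-! ### Smoothness of preservers -/

/-- The difference quotient of `f` with step `2⁻ᵏ`. Halving the step changes the quotient of a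
preserver of positive semidefiniteness by such a preserver, which makes these quotients converge. -/
noncomputable def dyadicQuotient (f : ℝ → ℝ) (k : ℕ) (t : ℝ) : ℝ :=
  2 ^ k * Δ_[(2 ^ k : ℝ)⁻¹] f t

theorem tendsto_inv_two_pow_nhdsNE_zero :
    Tendsto (fun k : ℕ => (2 ^ k : ℝ)⁻¹) atTop (𝓝[≠] 0) :=
  tendsto_nhdsWithin_iff.2 ⟨(tendsto_pow_atTop_atTop_of_one_lt one_lt_two).inv_tendsto_atTop,
    .of_forall fun k => by simp⟩

theorem tendsto_dyadicQuotient_of_hasDerivAt {f : ℝ → ℝ} {f' t : ℝ} (hf : HasDerivAt f f' t) :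
    Tendsto (dyadicQuotient f · t) atTop (𝓝 f') := by
  simpa [Function.comp_def, dyadicQuotient, fwdDiff] using
    hf.tendsto_slope_zero.comp tendsto_inv_two_pow_nhdsNE_zero

theorem hasDerivAt_dyadicQuotient {f f' : ℝ → ℝ} (hf : ∀ t, HasDerivAt f (f' t) t) (k : ℕ)
    (t : ℝ) : HasDerivAt (dyadicQuotient f k) (dyadicQuotient f' k t) t :=
  (((hf _).comp_add_const t _).sub (hf t)).const_mul _

namespace PreservesPosSemidef

variable {f : ℝ → ℝ}

protected theorem dyadicQuotient (hf : PreservesPosSemidef f) (k : ℕ) :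
    PreservesPosSemidef (dyadicQuotient f k) :=
  (hf.fwdDiff (by positivity)).const_mul (by positivity)

theorem dyadicQuotient_sub_succ (hf : PreservesPosSemidef f) (k : ℕ) :
    PreservesPosSemidef (dyadicQuotient f k - dyadicQuotient f (k + 1)) := by
  have hh : (0 : ℝ) ≤ (2 ^ (k + 1))⁻¹ := by positivity
  -- `Δ_[2h] f - 2 Δ_[h] f = Δ_[h] (Δ_[h] f)`
  convert ((hf.fwdDiff hh).fwdDiff hh).const_mul (c := 2 ^ k) (by positivity) using 1
  ext t
  have hstep : (2 ^ k : ℝ)⁻¹ = (2 ^ (k + 1))⁻¹ + (2 ^ (k + 1))⁻¹ := by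
    field_simp
    ring
  simp only [dyadicQuotient, fwdDiff, Pi.sub_apply, hstep, ← add_assoc]
  ring

theorem dyadicQuotient_sub (hf : PreservesPosSemidef f) {k l : ℕ} (hkl : k ≤ l) :
    PreservesPosSemidef (dyadicQuotient f k - dyadicQuotient f l) := by
  induction l, hkl using Nat.le_induction with
  | base => simpa using .zero
  | succ l _ ih => simpa using ih.add (hf.dyadicQuotient_sub_succ l)

theorem fwdDiff_inv_two_pow_le (hf : PreservesPosSemidef f) (k : ℕ) {T : ℝ} (hT : 0 ≤ T) :
    Δ_[(2 ^ k : ℝ)⁻¹] f T ≤ (2 ^ k)⁻¹ * Δ_[1] f T := by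
  have h := (hf.dyadicQuotient_sub k.zero_le).apply_nonneg hT
  rw [le_inv_mul_iff₀ (by positivity)]
  simpa [dyadicQuotient] using h

theorem abs_sub_le_fwdDiff (hf : PreservesPosSemidef f) {s t h T : ℝ} (hs : |s| ≤ T)
    (ht : |t| ≤ T) (hst : |t - s| ≤ h) : |f t - f s| ≤ Δ_[h] f T := by
  wlog hle : s ≤ t generalizing s t
  · rw [abs_sub_comm]
    exact this ht hs (by rwa [abs_sub_comm]) (le_of_not_ge hle)
  have hT : 0 ≤ T := (abs_nonneg s).trans hs
  have hts : 0 ≤ t - s := sub_nonneg.2 hle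
  rw [abs_of_nonneg hts] at hst
  calc |f t - f s| = |Δ_[t - s] f s| := by simp [fwdDiff]
    _ ≤ Δ_[t - s] f T := (hf.fwdDiff hts).abs_apply_le_of_abs_le hs
    _ ≤ Δ_[h] f T := sub_le_sub_right
      (hf.monotoneOn (add_nonneg hT hts) (add_nonneg hT (hts.trans hst)) (by gcongr)) _

protected theorem continuous (hf : PreservesPosSemidef f) : Continuous f := by
  refine continuous_iff_continuousAt.2 fun t => Metric.continuousAt_iff.2 fun ε hε => ?_
  have hlim := (tendsto_inv_two_pow_nhdsNE_zero.mono_right nhdsWithin_le_nhds).mul_const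
    (Δ_[1] f (|t| + 1))
  rw [zero_mul] at hlim
  obtain ⟨k, hk⟩ := (hlim.eventually_lt_const hε).exists
  refine ⟨min 1 (2 ^ k)⁻¹, by positivity, fun s hst => ?_⟩
  rw [Real.dist_eq, lt_min_iff] at hst
  have hs : |s| ≤ |t| + 1 := by linarith [abs_sub_abs_le_abs_sub s t]
  exact (hf.abs_sub_le_fwdDiff (by simp) hs hst.2.le).trans_lt
    ((hf.fwdDiff_inv_two_pow_le k (by positivity)).trans_lt hk)

theorem cauchySeq_dyadicQuotient (hf : PreservesPosSemidef f) {T : ℝ} (hT : 0 ≤ T) :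
    CauchySeq (dyadicQuotient f · T) := by
  refine (tendsto_atTop_ciInf ?_ ⟨0, ?_⟩).cauchySeq
  · exact fun k l hkl => sub_nonneg.1 ((hf.dyadicQuotient_sub hkl).apply_nonneg hT)
  · rintro _ ⟨k, rfl⟩
    exact (hf.dyadicQuotient k).apply_nonneg hT

theorem uniformCauchySeqOn_dyadicQuotient (hf : PreservesPosSemidef f) {T : ℝ} (hT : 0 ≤ T) :
    UniformCauchySeqOn (dyadicQuotient f) atTop (Icc (-T) T) := by
  refine Metric.uniformCauchySeqOn_iff.2 fun ε hε => ?_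
  obtain ⟨N, hN⟩ := Metric.cauchySeq_iff.1 (hf.cauchySeq_dyadicQuotient hT) ε hε
  refine ⟨N, fun k hk l hl t ht => ?_⟩
  wlog hkl : k ≤ l generalizing k l
  · rw [dist_comm]
    exact this l hl k hk (le_of_not_ge hkl)
  exact ((hf.dyadicQuotient_sub hkl).abs_apply_le_of_abs_le (abs_le.2 ht)).trans_lt
    ((le_abs_self _).trans_lt (hN k hk l hl))

theorem exists_tendsto_dyadicQuotient (hf : PreservesPosSemidef f) (t : ℝ) :
    ∃ l, Tendsto (dyadicQuotient f · t) atTop (𝓝 l) :=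
  cauchySeq_tendsto_of_complete
    ((hf.uniformCauchySeqOn_dyadicQuotient (abs_nonneg t)).cauchySeq (abs_le.1 le_rfl))

protected theorem hasDerivAt (hf : PreservesPosSemidef f) {g : ℝ → ℝ}
    (hg : ∀ t, Tendsto (dyadicQuotient f · t) atTop (𝓝 (g t))) (t : ℝ) :
    HasDerivAt f (g t) t := by
  -- The dyadic quotients of `f` are the derivatives of those of its primitive, so their uniform
  -- limit is the derivative of `f`.
  have hprim (s : ℝ) : HasDerivAt (fun u => ∫ v in 0..u, f v) (f s) s :=
    hf.continuous.integral_hasStrictDerivAt 0 s |>.hasDerivAt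
  have hunif : TendstoUniformlyOn (dyadicQuotient f) g atTop (Icc (-(|t| + 1)) (|t| + 1)) :=
    (hf.uniformCauchySeqOn_dyadicQuotient (by positivity)).tendstoUniformlyOn_of_tendsto
      fun s _ => hg s
  exact hasDerivAt_of_tendstoLocallyUniformlyOn isOpen_Ioo
    (hunif.mono Ioo_subset_Icc_self).tendstoLocallyUniformlyOn
    (.of_forall fun k s _ => hasDerivAt_dyadicQuotient hprim k s)
    (fun s _ => tendsto_dyadicQuotient_of_hasDerivAt (hprim s)) (abs_lt.1 (lt_add_one |t|))

theorem exists_hasDerivAt (hf : PreservesPosSemidef f) :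
    ∃ g, PreservesPosSemidef g ∧ ∀ t, HasDerivAt f (g t) t := by
  choose g hg using hf.exists_tendsto_dyadicQuotient
  exact ⟨g, .of_tendsto hf.dyadicQuotient hg, hf.hasDerivAt hg⟩

protected theorem differentiable (hf : PreservesPosSemidef f) : Differentiable ℝ f :=
  let ⟨_, _, hg⟩ := hf.exists_hasDerivAt
  fun t => (hg t).differentiableAt

protected theorem deriv (hf : PreservesPosSemidef f) : PreservesPosSemidef (deriv f) := by
  obtain ⟨g, hg, hderiv⟩ := hf.exists_hasDerivAt
  rwa [deriv_eq hderiv]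

protected theorem iteratedDeriv (hf : PreservesPosSemidef f) (n : ℕ) :
    PreservesPosSemidef (iteratedDeriv n f) := by
  induction n with
  | zero => rwa [iteratedDeriv_zero]
  | succ n ih => rw [iteratedDeriv_succ]; exact ih.deriv

protected theorem contDiff (hf : PreservesPosSemidef f) {n : ℕ∞} : ContDiff ℝ n f :=
  contDiff_of_differentiable_iteratedDeriv fun m _ => (hf.iteratedDeriv m).differentiable

end PreservesPosSemidef

/-! ### Power series of preservers -/

section Taylor

open scoped Nat

theorem exists_taylor_remainder {f : ℝ → ℝ} {n : ℕ} (hf : ContDiff ℝ n f) (s t : ℝ) :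
    ∃ ξ ∈ uIcc s t, f t - ∑ k ∈ Finset.range n, iteratedDeriv k f s / k ! * (t - s) ^ k =
      iteratedDeriv n f ξ / n ! * (t - s) ^ n := by
  rcases n with _ | n
  · exact ⟨t, by simp⟩
  rcases eq_or_ne s t with rfl | hst
  · exact ⟨s, by simp, by simp [Finset.sum_range_succ']⟩
  obtain ⟨ξ, hξ, htaylor⟩ := taylor_mean_remainder_lagrange_iteratedDeriv hst
    (by exact_mod_cast hf.contDiffOn)
  refine ⟨ξ, uIoo_subset_uIcc_self hξ, ?_⟩
  have hcoeff : ∀ k ∈ Finset.range (n + 1),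
      iteratedDerivWithin k f (uIcc s t) s = iteratedDeriv k f s := fun k hk =>
    iteratedDerivWithin_eq_iteratedDeriv (uniqueDiffOn_uIcc hst)
      (hf.contDiffAt.of_le (by exact_mod_cast (Finset.mem_range.1 hk).le)) left_mem_uIcc
  rw [div_mul_eq_mul_div, ← htaylor, taylor_within_apply]
  congr 1
  refine Finset.sum_congr rfl fun k hk => ?_
  rw [hcoeff k hk, smul_eq_mul]
  ring

namespace PreservesPosSemidef

variable {f : ℝ → ℝ}

theorem iteratedDeriv_div_factorial_mul_pow_le (hf : PreservesPosSemidef f) (n : ℕ) {T R : ℝ}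
    (hT : 0 ≤ T) (hR : 0 ≤ R) : iteratedDeriv n f T / n ! * R ^ n ≤ f (T + R) := by
  have hnonneg (k : ℕ) {t : ℝ} (ht : 0 ≤ t) := (hf.iteratedDeriv k).apply_nonneg ht
  obtain ⟨ξ, hξ, htaylor⟩ := exists_taylor_remainder (n := n) hf.contDiff T (T + R)
  rw [uIcc_of_le (by linarith)] at hξ
  have hmono := (hf.iteratedDeriv n).monotoneOn hT (hT.trans hξ.1) hξ.1
  simp only [add_sub_cancel_left] at htaylor
  calc iteratedDeriv n f T / n ! * R ^ n ≤ iteratedDeriv n f ξ / n ! * R ^ n := by gcongr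
    _ = f (T + R) - ∑ k ∈ Finset.range n, iteratedDeriv k f T / k ! * R ^ k := htaylor.symm
    _ ≤ f (T + R) := sub_le_self _ (Finset.sum_nonneg fun k _ => by
      have := hnonneg k hT
      positivity)

theorem abs_sub_sum_range_le (hf : PreservesPosSemidef f) (t : ℝ) (n : ℕ) :
    |f t - ∑ k ∈ Finset.range n, iteratedDeriv k f 0 / k ! * t ^ k| ≤ f (3 * |t|) / 2 ^ n := by
  obtain ⟨ξ, hξ, htaylor⟩ := exists_taylor_remainder (n := n) hf.contDiff 0 t
  have hξt : |ξ| ≤ |t| := by simpa using abs_sub_left_of_mem_uIcc hξ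
  simp only [sub_zero] at htaylor
  have hbound := hf.iteratedDeriv_div_factorial_mul_pow_le n (abs_nonneg t)
    (by positivity : 0 ≤ 2 * |t|)
  rw [le_div_iff₀ (by positivity), htaylor, abs_mul, abs_div, abs_pow, Nat.abs_cast]
  calc |iteratedDeriv n f ξ| / n ! * |t| ^ n * 2 ^ n
      ≤ iteratedDeriv n f |t| / n ! * |t| ^ n * 2 ^ n := by
        gcongr
        exact (hf.iteratedDeriv n).abs_apply_le_of_abs_le hξt
    _ = iteratedDeriv n f |t| / n ! * (2 * |t|) ^ n := by ring
    _ ≤ f (|t| + 2 * |t|) := hbound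
    _ = f (3 * |t|) := by ring_nf

theorem tendsto_taylor (hf : PreservesPosSemidef f) (t : ℝ) :
    Tendsto (fun n => ∑ k ∈ Finset.range n, iteratedDeriv k f 0 / k ! * t ^ k) atTop
      (𝓝 (f t)) := by
  have hbound : Tendsto (fun n : ℕ => f (3 * |t|) / 2 ^ n) atTop (𝓝 0) :=
    tendsto_const_nhds.div_atTop (tendsto_pow_atTop_atTop_of_one_lt one_lt_two)
  refine tendsto_iff_dist_tendsto_zero.2 (squeeze_zero (fun _ => dist_nonneg) (fun n => ?_) hbound)
  rw [Real.dist_eq, abs_sub_comm]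
  exact hf.abs_sub_sum_range_le t n

theorem hasSum_taylor (hf : PreservesPosSemidef f) (t : ℝ) :
    HasSum (fun n => iteratedDeriv n f 0 / n ! * t ^ n) (f t) := by
  have hcoeff (n : ℕ) : 0 ≤ iteratedDeriv n f 0 / n ! :=
    div_nonneg ((hf.iteratedDeriv n).apply_nonneg le_rfl) (Nat.cast_nonneg _)
  have habs : Summable fun n => iteratedDeriv n f 0 / n ! * |t| ^ n :=
    ((hasSum_iff_tendsto_nat_of_nonneg (fun n => mul_nonneg (hcoeff n) (by positivity)) _).2
      (hf.tendsto_taylor |t|)).summable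
  have hsum : Summable fun n => iteratedDeriv n f 0 / n ! * t ^ n :=
    .of_norm (habs.congr fun n => by
      rw [norm_mul, norm_pow, Real.norm_of_nonneg (hcoeff n), Real.norm_eq_abs])
  exact (hsum.hasSum_iff_tendsto_nat).2 (hf.tendsto_taylor t)

end PreservesPosSemidef

theorem preservesPosSemidef_iff {f : ℝ → ℝ} :
    PreservesPosSemidef f ↔
      ∃ a : ℕ → ℝ, (∀ n, 0 ≤ a n) ∧ ∀ t, HasSum (fun n => a n * t ^ n) (f t) :=
  ⟨fun hf => ⟨fun n => iteratedDeriv n f 0 / n !,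
    fun n => div_nonneg ((hf.iteratedDeriv n).apply_nonneg le_rfl) (Nat.cast_nonneg _),
    hf.hasSum_taylor⟩, fun ⟨_, ha, hf⟩ => .of_hasSum ha hf⟩

end Taylor

/-! ### Positive definite kernels -/

section Kernels

theorem sum_mul_conj_mul_ofReal {ι : Type*} [Fintype ι] {A : Matrix ι ι ℝ} (hA : A.IsHermitian)
    (c : ι → ℂ) :
    ∑ i, ∑ j, c i * (starRingEnd ℂ) (c j) * (A i j : ℂ) =
      (((fun i => (c i).re) ⬝ᵥ A *ᵥ (fun i => (c i).re) +
        (fun i => (c i).im) ⬝ᵥ A *ᵥ fun i => (c i).im : ℝ) : ℂ) := by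
  simp only [dotProduct, mulVec, Finset.mul_sum]
  refine Complex.ext ?_ ?_
  · simp only [Complex.re_sum, Complex.ofReal_re, ← Finset.sum_add_distrib]
    refine Finset.sum_congr rfl fun i _ => Finset.sum_congr rfl fun j _ => ?_
    simp only [Complex.mul_re, Complex.mul_im, Complex.conj_re, Complex.conj_im,
      Complex.ofReal_re, Complex.ofReal_im]
    ring
  · have him (i j : ι) : (c i * (starRingEnd ℂ) (c j) * (A i j : ℂ)).im =
        (c i).im * (c j).re * A i j - (c i).re * (c j).im * A i j := by
      simp only [Complex.mul_re, Complex.mul_im, Complex.conj_re, Complex.conj_im,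
        Complex.ofReal_re, Complex.ofReal_im]
      ring
    simp only [Complex.im_sum, Complex.ofReal_im, him, Finset.sum_sub_distrib]
    rw [sub_eq_zero, Finset.sum_comm]
    refine Finset.sum_congr rfl fun i _ => Finset.sum_congr rfl fun j _ => ?_
    rw [← hA.apply i j, star_trivial]
    ring

open scoped ComplexOrder in
theorem forall_sum_mul_conj_mul_nonneg_iff {ι : Type*} [Fintype ι] {A : Matrix ι ι ℝ}
    (hA : A.IsHermitian) :
    (∀ c : ι → ℂ, 0 ≤ ∑ i, ∑ j, c i * (starRingEnd ℂ) (c j) * (A i j : ℂ)) ↔ A.PosSemidef := by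
  simp only [sum_mul_conj_mul_ofReal hA, Complex.zero_le_real]
  refine ⟨fun h => .of_dotProduct_mulVec_nonneg hA fun c => ?_, fun h c => ?_⟩
  · simpa using h fun i => (c i : ℂ)
  · exact add_nonneg (h.dotProduct_mulVec_nonneg _) (h.dotProduct_mulVec_nonneg _)

open scoped ComplexOrder in
theorem forall_sum_mul_conj_mul_pos_iff {ι : Type*} [Fintype ι] {A : Matrix ι ι ℝ}
    (hA : A.IsHermitian) :
    (∀ c : ι → ℂ, c ≠ 0 → 0 < ∑ i, ∑ j, c i * (starRingEnd ℂ) (c j) * (A i j : ℂ)) ↔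
      A.PosDef := by
  simp only [sum_mul_conj_mul_ofReal hA, Complex.zero_lt_real]
  refine ⟨fun h => .of_dotProduct_mulVec_pos hA fun c hc => ?_, fun h c hc => ?_⟩
  · have hc' : (fun i => (c i : ℂ)) ≠ 0 := fun h0 => hc (funext fun i => by
      simpa using congrFun h0 i)
    simpa using h _ hc'
  · by_cases hre : (fun i => (c i).re) = 0
    · have him : (fun i => (c i).im) ≠ 0 := fun him => hc (funext fun i =>
        Complex.ext (congrFun hre i) (congrFun him i))
      exact add_pos_of_nonneg_of_pos (h.posSemidef.dotProduct_mulVec_nonneg _)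
        (h.dotProduct_mulVec_pos him)
    · exact add_pos_of_pos_of_nonneg (h.dotProduct_mulVec_pos hre)
        (h.posSemidef.dotProduct_mulVec_nonneg _)

variable {X : Type*}

theorem isPosDefKernel_ofReal_iff {k : X → X → ℝ} (hk : ∀ x y, k x y = k y x) :
    IsPosDefKernel (fun x y => (k x y : ℂ)) ↔
      ∀ (m : ℕ) (x : Fin m → X), (of fun i j => k (x i) (x j)).PosSemidef :=
  forall₂_congr fun _ x => forall_sum_mul_conj_mul_nonneg_iff (A := of fun i j => k (x i) (x j))
    (.ext fun _ _ => hk _ _)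

theorem isStrictlyPosDefKernel_ofReal_iff {k : X → X → ℝ} (hk : ∀ x y, k x y = k y x) :
    IsStrictlyPosDefKernel (fun x y => (k x y : ℂ)) ↔
      IsPosDefKernel (fun x y => (k x y : ℂ)) ∧
      ∀ (m : ℕ) (x : Fin m → X), x.Injective → (of fun i j => k (x i) (x j)).PosDef := by
  refine and_congr_right fun _ => forall₂_congr fun _ x => ?_
  have hpos := forall_sum_mul_conj_mul_pos_iff (A := of fun i j => k (x i) (x j))
    (.ext fun _ _ => hk _ _)
  exact ⟨fun h hx => hpos.1 fun c => h c hx, fun h c hx => hpos.2 (h hx) c⟩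

theorem IsPosDefKernel.conj_apply {K : X → X → ℂ} (hK : IsPosDefKernel K) (x y : X) :
    (starRingEnd ℂ) (K x y) = K y x := by
  have h (u v : ℂ) : (u * (starRingEnd ℂ) u * K x x + u * (starRingEnd ℂ) v * K x y +
      (v * (starRingEnd ℂ) u * K y x + v * (starRingEnd ℂ) v * K y y)).im = 0 := by
    simpa [Fin.sum_univ_two] using (Complex.le_def.1 (hK 2 ![x, y] ![u, v])).2.symm
  have hx : (K x x).im = 0 := by simpa using h 1 0
  have hy : (K y y).im = 0 := by simpa using h 0 1
  have him : (K x y).im + (K y x).im = 0 := by simpa [hx, hy] using h 1 1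
  have hre : -(K x y).re + (K y x).re = 0 := by simpa [hx, hy] using h 1 Complex.I
  refine Complex.ext ?_ ?_
  · rw [Complex.conj_re]
    linarith
  · rw [Complex.conj_im]
    linarith

variable {E : Type*} [NormedAddCommGroup E] [InnerProductSpace ℝ E]

theorem exists_orthonormal_nat (hE : ¬ FiniteDimensional ℝ E) : ∃ e : ℕ → E, Orthonormal ℝ e := by
  let b := Module.Free.chooseBasis ℝ E
  have : Infinite (Module.Free.ChooseBasisIndex ℝ E) :=
    not_finite_iff_infinite.1 fun _ => hE (Module.Finite.of_basis b)
  exact ⟨_, InnerProductSpace.gramSchmidtNormed_orthonormal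
    (b.linearIndependent.comp _ (Infinite.natEmbedding _).injective)⟩

theorem exists_gram_eq (hE : ¬ FiniteDimensional ℝ E) {ι : Type*} [Finite ι] {A : Matrix ι ι ℝ}
    (hA : A.PosSemidef) : ∃ x : ι → E, gram ℝ x = A := by
  obtain ⟨e, he⟩ := exists_orthonormal_nat hE
  obtain ⟨m, v, rfl⟩ := posSemidef_iff_eq_sum_vecMulVec.1 hA
  have hfin : Orthonormal ℝ fun k : Fin m => e k := he.comp _ Fin.val_injective
  refine ⟨fun i => ∑ k, v k i • e k, Matrix.ext fun i j => ?_⟩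
  rw [gram_apply, hfin.inner_sum (v · i) (v · j), Matrix.sum_apply]
  simp [vecMulVec_apply]

theorem isPosDefKernel_comp_inner_iff (hE : ¬ FiniteDimensional ℝ E) {f : ℝ → ℝ} :
    IsPosDefKernel (fun x y : E => (f (inner ℝ x y) : ℂ)) ↔ PreservesPosSemidef f := by
  rw [isPosDefKernel_ofReal_iff fun x y => by rw [real_inner_comm]]
  refine ⟨fun h ι _ A hA => ?_, fun hf m x => hf _ _ (posSemidef_gram ℝ x)⟩
  obtain ⟨m, ⟨σ⟩⟩ := Finite.exists_equiv_fin ι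
  obtain ⟨x, rfl⟩ := exists_gram_eq hE hA
  exact (posSemidef_submatrix_equiv σ.symm).1 (h m (x ∘ σ.symm))

theorem IsPosDefKernel.exists_eq_ofReal_comp_inner {K : E → E → ℂ} (hK : IsPosDefKernel K)
    {κ : ℝ → ℂ} (hκ : ∀ x y, K x y = κ (inner ℝ x y)) :
    ∃ f : ℝ → ℝ, K = fun x y => (f (inner ℝ x y) : ℂ) := by
  refine ⟨fun t => (κ t).re, funext₂ fun x y => ?_⟩
  change K x y = ((κ (inner ℝ x y)).re : ℂ)
  rw [← hκ, eq_comm, ← Complex.conj_eq_iff_re, hK.conj_apply, hκ, hκ, real_inner_comm]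

/-- `K(x, y) = ∑ aₙ ⟨x, y⟩ⁿ` for all `x` and `y`; on `ℓ²` this unfolds to
`HasDotProductExpansion`. -/
def HasInnerPowerSeries (K : E → E → ℂ) (a : ℕ → ℝ) : Prop :=
  ∀ x y : E, HasSum (fun n : ℕ => ((a n * inner ℝ x y ^ n : ℝ) : ℂ)) (K x y)

theorem hasInnerPowerSeries_ofReal {f : ℝ → ℝ} {a : ℕ → ℝ}
    (hf : ∀ t, HasSum (fun n => a n * t ^ n) (f t)) :
    HasInnerPowerSeries (fun x y : E => (f (inner ℝ x y) : ℂ)) a :=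
  fun _ _ => Complex.hasSum_ofReal.2 (hf _)

theorem HasInnerPowerSeries.exists_eq_ofReal [Nontrivial E] {K : E → E → ℂ} {a : ℕ → ℝ}
    (hK : HasInnerPowerSeries K a) :
    ∃ f : ℝ → ℝ, (∀ t, HasSum (fun n => a n * t ^ n) (f t)) ∧
      K = fun x y => (f (inner ℝ x y) : ℂ) := by
  obtain ⟨e, he⟩ := exists_norm_eq E zero_le_one
  have hsummable (t : ℝ) : Summable fun n => a n * t ^ n := by
    have hinner : inner ℝ (t • e) e = t := by
      rw [real_inner_smul_left, real_inner_self_eq_norm_sq, he, one_pow, mul_one]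
    simpa only [hinner] using Complex.summable_ofReal.1 (hK (t • e) e).summable
  refine ⟨fun t => ∑' n, a n * t ^ n, fun t => (hsummable t).hasSum, ?_⟩
  ext x y
  exact (hK x y).unique (Complex.hasSum_ofReal.2 (hsummable _).hasSum)

theorem eq_of_forall_hasSum_mul_pow {a b : ℕ → ℝ} {f : ℝ → ℝ}
    (ha : ∀ t, HasSum (fun n => a n * t ^ n) (f t))
    (hb : ∀ t, HasSum (fun n => b n * t ^ n) (f t)) : a = b := by
  have hseries {c : ℕ → ℝ} (hc : ∀ t, HasSum (fun n => c n * t ^ n) (f t)) :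
      HasFPowerSeriesAt f (FormalMultilinearSeries.ofScalars ℝ c) 0 :=
    hasFPowerSeriesAt_iff.2 (.of_forall fun t => by
      simpa [FormalMultilinearSeries.coeff_ofScalars, mul_comm] using hc t)
  ext n
  simpa [FormalMultilinearSeries.coeff_ofScalars] using
    congrArg (fun p => p.coeff n) ((hseries ha).eq_formalMultilinearSeries (hseries hb))

theorem PreservesPosSemidef.coeff_nonneg {f : ℝ → ℝ} (hf : PreservesPosSemidef f) {a : ℕ → ℝ}
    (ha : ∀ t, HasSum (fun n => a n * t ^ n) (f t)) (n : ℕ) : 0 ≤ a n := by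
  obtain ⟨b, hb, hsum⟩ := preservesPosSemidef_iff.1 hf
  rw [eq_of_forall_hasSum_mul_pow ha hsum]
  exact hb n

end Kernels

/-! ### Strict positive definiteness -/

section Strictness

theorem hasSum_dotProduct_map_mulVec {ι : Type*} [Fintype ι] {f : ℝ → ℝ} {a : ℕ → ℝ}
    (hf : ∀ t, HasSum (fun n => a n * t ^ n) (f t)) (A : Matrix ι ι ℝ) (c : ι → ℝ) :
    HasSum (fun n => a n * (star c ⬝ᵥ A.map (· ^ n) *ᵥ c)) (star c ⬝ᵥ A.map f *ᵥ c) := by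
  simp only [dotProduct, mulVec, Finset.mul_sum, map_apply]
  refine hasSum_sum fun i _ => hasSum_sum fun j _ => ?_
  simpa only [mul_assoc, mul_comm, mul_left_comm] using (hf (A i j)).mul_left (star c i * c j)

theorem sum_filter_eq_one_eq_zero_of_frequently {ι : Type*} [Fintype ι] {c t : ι → ℝ}
    (ht : ∀ i, c i ≠ 0 → |t i| ≤ 1)
    (heven : ∃ᶠ n in atTop, Even n ∧ ∑ i, c i * t i ^ n = 0)
    (hodd : ∃ᶠ n in atTop, Odd n ∧ ∑ i, c i * t i ^ n = 0) :
    ∑ i with t i = 1, c i = 0 := by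
  set u := ∑ i with t i = 1, c i
  set v := ∑ i with t i = -1, c i
  have hterm (i : ι) : Tendsto (fun n => c i * t i ^ n - ((if t i = 1 then c i else 0) +
      (-1) ^ n * if t i = -1 then c i else 0)) atTop (𝓝 0) := by
    by_cases hc : c i = 0
    · simp [hc]
    by_cases h1 : t i = 1
    · norm_num [h1]
    by_cases h2 : t i = -1
    · norm_num [h2, mul_comm]
    have hlt : |t i| < 1 := (ht i hc).lt_of_ne fun h => by
      rcases eq_or_eq_neg_of_abs_eq h with h | h <;> contradiction
    simpa [h1, h2] using (tendsto_pow_atTop_nhds_zero_of_abs_lt_one hlt).const_mul (c i)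
  have hlim : Tendsto (fun n => ∑ i, c i * t i ^ n - (u + (-1) ^ n * v)) atTop (𝓝 0) := by
    simpa [u, v, Finset.sum_filter, Finset.mul_sum, Finset.sum_add_distrib,
      Finset.sum_sub_distrib] using tendsto_finsetSum Finset.univ fun i _ => hterm i
  have hsum : 0 = -(u + v) := tendsto_nhds_unique_of_frequently_eq hlim tendsto_const_nhds <|
    heven.mono fun n hn => by rw [hn.2, hn.1.neg_one_pow, one_mul, zero_sub]
  have hdiff : 0 = -(u - v) := tendsto_nhds_unique_of_frequently_eq hlim tendsto_const_nhds <|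
    hodd.mono fun n hn => by rw [hn.2, hn.1.neg_one_pow]; ring
  linarith

variable {E : Type*} [NormedAddCommGroup E] [InnerProductSpace ℝ E] {ι : Type*} [Fintype ι]

theorem eq_of_norm_le_of_inner_eq {x y : E} (hnorm : ‖x‖ ≤ ‖y‖) (hinner : inner ℝ x y = ‖y‖ ^ 2) :
    x = y := by
  have hsq : ‖x‖ ^ 2 ≤ ‖y‖ ^ 2 := by gcongr
  have hsub := norm_sub_sq_real x y
  exact sub_eq_zero.1 (norm_eq_zero.1 (sq_eq_zero_iff.1 (by nlinarith [sq_nonneg ‖x - y‖])))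

theorem coeff_eq_zero_of_forall_norm_le {x : ι → E} (hx : x.Injective) {c : ι → ℝ} {j : ι}
    (hj : x j ≠ 0) (hmax : ∀ i, c i ≠ 0 → ‖x i‖ ≤ ‖x j‖)
    (heven : ∃ᶠ n in atTop, Even n ∧ ∑ i, inner ℝ (x j) (x i) ^ n * c i = 0)
    (hodd : ∃ᶠ n in atTop, Odd n ∧ ∑ i, inner ℝ (x j) (x i) ^ n * c i = 0) : c j = 0 := by
  -- By maximality of `‖x j‖`, the numbers `t i = ⟪x j, x i⟫ / ‖x j‖²` that carry a nonzero weight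
  -- lie in `[-1, 1]`, and equal `1` only for `i = j`.
  have hnorm : ‖x j‖ ^ 2 ≠ 0 := by positivity
  set t : ι → ℝ := fun i => inner ℝ (x j) (x i) / ‖x j‖ ^ 2
  have hle (i : ι) (hi : c i ≠ 0) : |t i| ≤ 1 := by
    rw [abs_div, abs_of_nonneg (sq_nonneg ‖x j‖), div_le_one (by positivity), sq]
    exact (abs_real_inner_le_norm _ _).trans (by gcongr; exact hmax i hi)
  have hone (i : ι) (hi : c i ≠ 0) (hti : t i = 1) : i = j :=
    hx (eq_of_norm_le_of_inner_eq (hmax i hi) (by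
      rw [real_inner_comm, (div_eq_one_iff_eq hnorm).1 hti]))
  have hscale (n : ℕ) (h : ∑ i, inner ℝ (x j) (x i) ^ n * c i = 0) : ∑ i, c i * t i ^ n = 0 := by
    rw [← zero_div ((‖x j‖ ^ 2) ^ n), ← h, Finset.sum_div]
    exact Finset.sum_congr rfl fun i _ => by rw [div_pow, mul_div_assoc', mul_comm]
  have hsum := sum_filter_eq_one_eq_zero_of_frequently hle
    (heven.mono fun n hn => ⟨hn.1, hscale n hn.2⟩) (hodd.mono fun n hn => ⟨hn.1, hscale n hn.2⟩)
  have hjj : t j = 1 := by rw [div_eq_one_iff_eq hnorm, real_inner_self_eq_norm_sq]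
  rwa [Finset.sum_eq_single j (fun i hi hij => ?_) (by simp [hjj])] at hsum
  by_contra hci
  exact hij (hone i hci (Finset.mem_filter.1 hi).2)

theorem eq_zero_of_forall_sum_inner_pow_mul_eq_zero {x : ι → E} (hx : x.Injective) {c : ι → ℝ}
    {s : Set ℕ} (heven : {n | Even n ∧ n ∈ s}.Infinite) (hodd : {n | Odd n ∧ n ∈ s}.Infinite)
    (hzero : 0 ∈ s ∨ ∀ i, x i ≠ 0)
    (hsum : ∀ n ∈ s, ∀ j, ∑ i, inner ℝ (x j) (x i) ^ n * c i = 0) : c = 0 := by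
  classical
  by_contra! hc
  obtain ⟨i₀, hi₀⟩ := Function.ne_iff.1 hc
  obtain ⟨j, hj, hmax⟩ := Finset.exists_max_image {i | c i ≠ 0} (‖x ·‖) ⟨i₀, by simpa using hi₀⟩
  replace hj : c j ≠ 0 := by simpa using hj
  replace hmax (i : ι) (hi : c i ≠ 0) : ‖x i‖ ≤ ‖x j‖ := hmax i (by simpa using hi)
  rcases eq_or_ne (x j) 0 with hxj | hxj
  · have hsupp (i : ι) (hij : i ≠ j) : c i = 0 := by
      by_contra hci
      have hxi : x i = 0 := by simpa [hxj] using hmax i hci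
      exact hij (hx (hxi.trans hxj.symm))
    have hsum₀ := hsum 0 (hzero.resolve_right fun h => h j hxj) j
    simp only [pow_zero, one_mul] at hsum₀
    rw [Finset.sum_eq_single j (fun i _ => hsupp i) (by simp)] at hsum₀
    exact hj hsum₀
  · exact hj (coeff_eq_zero_of_forall_norm_le hx hxj hmax
      ((Nat.frequently_atTop_iff_infinite.2 heven).mono fun n hn => ⟨hn.1, hsum n hn.2 j⟩)
      ((Nat.frequently_atTop_iff_infinite.2 hodd).mono fun n hn => ⟨hn.1, hsum n hn.2 j⟩))

theorem posDef_gram_map {f : ℝ → ℝ} {a : ℕ → ℝ} (ha : ∀ n, 0 ≤ a n)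
    (hf : ∀ t, HasSum (fun n => a n * t ^ n) (f t)) {ι : Type} [Finite ι] {x : ι → E}
    (hx : x.Injective) (heven : {n | Even n ∧ 0 < a n}.Infinite)
    (hodd : {n | Odd n ∧ 0 < a n}.Infinite) (hzero : 0 < a 0 ∨ ∀ i, x i ≠ 0) :
    ((gram ℝ x).map f).PosDef := by
  have := Fintype.ofFinite ι
  have hpow (n : ℕ) : ((gram ℝ x).map (· ^ n)).PosSemidef :=
    PreservesPosSemidef.pow n ι _ (posSemidef_gram ℝ x)
  have hpsd : ((gram ℝ x).map f).PosSemidef :=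
    PreservesPosSemidef.of_hasSum ha hf ι _ (posSemidef_gram ℝ x)
  refine .of_dotProduct_mulVec_pos hpsd.isHermitian fun c hc =>
    (hpsd.dotProduct_mulVec_nonneg c).lt_of_ne' fun h0 => hc ?_
  have hterms := (hasSum_zero_iff_of_nonneg fun n =>
    mul_nonneg (ha n) ((hpow n).dotProduct_mulVec_nonneg c)).1
    (h0 ▸ hasSum_dotProduct_map_mulVec hf (gram ℝ x) c)
  refine eq_zero_of_forall_sum_inner_pow_mul_eq_zero (s := {n | 0 < a n}) hx heven hodd hzero
    fun n (hn : 0 < a n) j => ?_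
  have hform := (mul_eq_zero.1 (congrFun hterms n)).resolve_left hn.ne'
  exact congrFun (((hpow n).dotProduct_mulVec_zero_iff c).1 hform) j

theorem exists_ne_zero_forall_sum_mul_pow_eq_zero {κ : Type*} [Fintype κ] (t : κ → ℝ) (s : Finset ℕ)
    (hs : s.card < Fintype.card κ) :
    ∃ d : κ → ℝ, d ≠ 0 ∧ ∀ n ∈ s, ∑ k, d k * t k ^ n = 0 := by
  have hdep : ¬ LinearIndependent ℝ fun (k : κ) (n : s) => t k ^ (n : ℕ) := fun h => by
    simpa using hs.trans_le h.fintype_card_le_finrank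
  obtain ⟨d, hd, k, hk⟩ := Fintype.not_linearIndependent_iff.1 hdep
  refine ⟨d, fun h => hk (congrFun h k), fun n hn => ?_⟩
  simpa using congrFun hd ⟨n, hn⟩

theorem exists_ne_zero_forall_sum_mul_pow_eq_zero_or_neg_one_pow {ε : ℝ} (hε : ε = 1 ∨ ε = -1)
    (s : Finset ℕ) :
    ∃ (m : ℕ) (t c : Fin m → ℝ), t.Injective ∧ (∀ i, t i ≠ 0) ∧ c ≠ 0 ∧
      ∀ n, ∑ i, c i * t i ^ n = 0 ∨ (-1) ^ n = ε ∧ n ∉ s := by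
  -- Points `±p k` with weights `d k` and `ε * d k` kill the moments of one parity; the choice of
  -- `d` kills the finitely many moments in `s`.
  set p : Fin (s.card + 1) → ℝ := fun k => k + 1
  have hp (k) : 0 < p k := by positivity
  have hinj : p.Injective := fun k l h => by simpa [p, Fin.val_inj] using h
  obtain ⟨d, hd, hmom⟩ := exists_ne_zero_forall_sum_mul_pow_eq_zero p s (by simp)
  have hsum (n : ℕ) : ∑ i, Fin.append d (ε • d) i * Fin.append p (-p) i ^ n =
      (1 + ε * (-1) ^ n) * ∑ k, d k * p k ^ n := by
    rw [Fin.sum_univ_add]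
    simp only [Fin.append_left, Fin.append_right, Pi.smul_apply, Pi.neg_apply, smul_eq_mul,
      neg_pow (p _), add_mul, one_mul, Finset.mul_sum]
    rw [← Finset.sum_add_distrib]
    exact Finset.sum_congr rfl fun k _ => by ring
  refine ⟨_, Fin.append p (-p), Fin.append d (ε • d), ?_, ?_, ?_, fun n => ?_⟩
  · refine Fin.append_injective_iff.2 ⟨hinj, neg_injective.comp hinj, fun k l => ?_⟩
    exact ((neg_lt_zero.2 (hp l)).trans (hp k)).ne'
  · refine Fin.addCases (fun k => ?_) fun k => ?_
    · rw [Fin.append_left]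
      exact (hp k).ne'
    · rw [Fin.append_right]
      exact neg_ne_zero.2 (hp k).ne'
  · exact fun h => hd (funext fun k => by simpa using congrFun h (Fin.castAdd _ k))
  · rw [hsum, mul_eq_zero]
    by_cases hn : n ∈ s
    · exact .inl (.inr (hmom n hn))
    · rcases hε with rfl | rfl <;> rcases neg_one_pow_eq_or ℝ n with h | h <;> norm_num [h, hn]

theorem infinite_neg_one_pow_eq_and_coeff_pos {f : ℝ → ℝ} {a : ℕ → ℝ} (ha : ∀ n, 0 ≤ a n)
    (hf : ∀ t, HasSum (fun n => a n * t ^ n) (f t))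
    (hpos : ∀ (m : ℕ) (t : Fin m → ℝ), t.Injective → (∀ i, t i ≠ 0) →
      ((vecMulVec t t).map f).PosDef) {ε : ℝ} (hε : ε = 1 ∨ ε = -1) :
    {n | (-1) ^ n = ε ∧ 0 < a n}.Infinite := by
  intro hfin
  obtain ⟨m, t, c, ht, ht0, hc, hmom⟩ :=
    exists_ne_zero_forall_sum_mul_pow_eq_zero_or_neg_one_pow hε hfin.toFinset
  have hrank (n : ℕ) : (vecMulVec t t).map (· ^ n) = vecMulVec (t ^ n) (t ^ n) :=
    Matrix.ext fun i j => mul_pow (t i) (t j) n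
  have hterm (n : ℕ) : a n * (star c ⬝ᵥ (vecMulVec t t).map (· ^ n) *ᵥ c) = 0 := by
    rcases hmom n with hn | ⟨hn, hns⟩
    · have hdot : c ⬝ᵥ t ^ n = 0 := hn
      simp [hrank, vecMulVec_mulVec, hdot]
    · have han : ¬ 0 < a n := fun han => hns (hfin.mem_toFinset.2 ⟨hn, han⟩)
      rw [le_antisymm (not_lt.1 han) (ha n), zero_mul]
  have hform := hasSum_dotProduct_map_mulVec hf (vecMulVec t t) c
  simp only [hterm] at hform
  exact ((hpos m t ht ht0).dotProduct_mulVec_pos hc).ne (hasSum_zero.unique hform)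

end Strictness

section DotProductKernels

variable {E : Type*} [NormedAddCommGroup E] [InnerProductSpace ℝ E] {f : ℝ → ℝ} {a : ℕ → ℝ}

theorem infinite_even_and_infinite_odd_coeff_pos [Nontrivial E] (ha : ∀ n, 0 ≤ a n)
    (hf : ∀ t, HasSum (fun n => a n * t ^ n) (f t))
    (hpos : ∀ (m : ℕ) (x : Fin m → E), x.Injective → (∀ i, x i ≠ 0) →
      ((gram ℝ x).map f).PosDef) :
    {n | Even n ∧ 0 < a n}.Infinite ∧ {n | Odd n ∧ 0 < a n}.Infinite := by
  obtain ⟨e, he⟩ := exists_norm_eq E zero_le_one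
  have he0 : e ≠ 0 := norm_ne_zero_iff.1 (he ▸ one_ne_zero)
  have hline (m : ℕ) (t : Fin m → ℝ) (ht : t.Injective) (ht0 : ∀ i, t i ≠ 0) :
      ((vecMulVec t t).map f).PosDef := by
    have hgram : gram ℝ (fun i => t i • e) = vecMulVec t t := by
      ext i j
      rw [gram_apply, vecMulVec_apply, real_inner_smul_left, real_inner_smul_right,
        real_inner_self_eq_norm_sq, he, one_pow, mul_one]
    rw [← hgram]
    exact hpos m _ ((smul_left_injective ℝ he0).comp ht) fun i => smul_ne_zero (ht0 i) he0
  constructor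
  · simpa only [neg_one_pow_eq_one_iff_even (by norm_num : (-1 : ℝ) ≠ 1)] using
      infinite_neg_one_pow_eq_and_coeff_pos ha hf hline (.inl rfl)
  · simpa only [neg_one_pow_eq_neg_one_iff_odd (by norm_num : (-1 : ℝ) ≠ 1)] using
      infinite_neg_one_pow_eq_and_coeff_pos ha hf hline (.inr rfl)

theorem isStrictlyPosDefKernel_comp_inner_iff [Nontrivial E] (ha : ∀ n, 0 ≤ a n)
    (hf : ∀ t, HasSum (fun n => a n * t ^ n) (f t)) {X : Type*} {φ : X → E} (hφ : φ.Injective)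
    (hrange : {0}ᶜ ⊆ range φ) :
    IsStrictlyPosDefKernel (fun x y => (f (inner ℝ (φ x) (φ y)) : ℂ)) ↔
      (0 ∈ range φ → 0 < a 0) ∧
        {n | Even n ∧ 0 < a n}.Infinite ∧ {n | Odd n ∧ 0 < a n}.Infinite := by
  have hsymm (x y : X) : f (inner ℝ (φ x) (φ y)) = f (inner ℝ (φ y) (φ x)) := by
    rw [real_inner_comm]
  rw [isStrictlyPosDefKernel_ofReal_iff hsymm]
  constructor
  · rintro ⟨-, hpos⟩
    refine ⟨?_, infinite_even_and_infinite_odd_coeff_pos (E := E) ha hf fun m x hx hx0 => ?_⟩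
    · rintro ⟨x, hx⟩
      have hf0 : HasSum (fun n => a n * 0 ^ n) (a 0) := by
        simpa using hasSum_single (f := fun n => a n * 0 ^ n) 0 fun n hn => by simp [hn]
      have h1 := (hpos 1 (fun _ => x) (Function.injective_of_subsingleton _)).diag_pos (i := 0)
      rwa [of_apply, hx, inner_zero_left, (hf 0).unique hf0] at h1
    · choose y hy using fun i => hrange (hx0 i)
      obtain rfl : φ ∘ y = x := funext hy
      exact hpos m y hx.of_comp
  · rintro ⟨h0, heven, hodd⟩
    refine ⟨(isPosDefKernel_ofReal_iff hsymm).2 fun m x =>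
      PreservesPosSemidef.of_hasSum ha hf _ _ (posSemidef_gram ℝ (φ ∘ x)), fun m x hx =>
      posDef_gram_map ha hf (hφ.comp hx) heven hodd ?_⟩
    by_cases hzero : 0 ∈ range φ
    · exact .inl (h0 hzero)
    · exact .inr fun i hi => hzero ⟨x i, hi⟩

end DotProductKernels

end

theorem mainTheorem5_general {E : Type*} [NormedAddCommGroup E] [InnerProductSpace ℝ E]
    (hE : ¬ FiniteDimensional ℝ E) :
    (∀ K : E → E → ℂ, (∃ κ : ℝ → ℂ, ∀ x y, K x y = κ (inner ℝ x y)) → IsPosDefKernel K →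
      ∃ a : ℕ → ℝ, (∀ n, 0 ≤ a n) ∧ (∀ t : ℝ, Summable fun n => a n * t ^ n) ∧
        HasInnerPowerSeries K a) ∧
    (∀ a : ℕ → ℝ, (∀ n, 0 ≤ a n) → (∀ t : ℝ, Summable fun n => a n * t ^ n) →
      ∃ K : E → E → ℂ, HasInnerPowerSeries K a ∧ (∃ κ : ℝ → ℂ, ∀ x y, K x y = κ (inner ℝ x y)) ∧
        Continuous (Function.uncurry K) ∧ IsPosDefKernel K) ∧
    (∀ (K : E → E → ℂ) (a : ℕ → ℝ), IsPosDefKernel K → HasInnerPowerSeries K a →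
      (IsStrictlyPosDefKernel K ↔
        0 < a 0 ∧ {n | Even n ∧ 0 < a n}.Infinite ∧ {n | Odd n ∧ 0 < a n}.Infinite) ∧
      (IsStrictlyPosDefKernel (fun x y : {x : E // x ≠ 0} => K x.1 y.1) ↔
        {n | Even n ∧ 0 < a n}.Infinite ∧ {n | Odd n ∧ 0 < a n}.Infinite)) := by
  have : Nontrivial E := not_subsingleton_iff_nontrivial.1 fun _ => hE inferInstance
  refine ⟨?_, fun a ha hsum => ?_, fun K a hK hKa => ?_⟩
  · rintro K ⟨κ, hκ⟩ hK
    obtain ⟨f, rfl⟩ := hK.exists_eq_ofReal_comp_inner hκ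
    obtain ⟨a, ha, hf⟩ := preservesPosSemidef_iff.1 ((isPosDefKernel_comp_inner_iff hE).1 hK)
    exact ⟨a, ha, fun t => (hf t).summable, hasInnerPowerSeries_ofReal hf⟩
  · choose f hf using hsum
    have hpres := PreservesPosSemidef.of_hasSum ha hf
    refine ⟨fun x y => (f (inner ℝ x y) : ℂ), hasInnerPowerSeries_ofReal hf,
      ⟨fun t => f t, fun _ _ => rfl⟩, ?_, (isPosDefKernel_comp_inner_iff hE).2 hpres⟩
    exact Complex.continuous_ofReal.comp (hpres.continuous.comp continuous_inner)
  · obtain ⟨f, hf, rfl⟩ := hKa.exists_eq_ofReal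
    have ha := ((isPosDefKernel_comp_inner_iff hE).1 hK).coeff_nonneg hf
    constructor
    · simpa using isStrictlyPosDefKernel_comp_inner_iff ha hf (E := E) Function.injective_id
    · simpa using isStrictlyPosDefKernel_comp_inner_iff ha hf
        (φ := ((↑) : {x : E // x ≠ 0} → E)) Subtype.val_injective fun x hx => ⟨⟨x, hx⟩, rfl⟩

theorem not_finiteDimensional_ellTwo : ¬ FiniteDimensional ℝ EllTwo := fun _ => by
  have horth : Orthonormal ℝ fun k : ℕ => (lp.single 2 k (1 : ℝ) : EllTwo) :=
    orthonormal_iff_ite.2 fun i j => by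
      rw [lp.inner_single_left]
      simp [lp.single_apply, Pi.single_apply]
  exact Infinite.not_finite horth.linearIndependent.finite

theorem mainTheorem5 :
    (∀ K : EllTwo → EllTwo → ℂ,
      IsDotProductFunction K → Continuous (Function.uncurry K) → IsPosDefKernel K →
        ∃ a : ℕ → ℝ, (∀ n, 0 ≤ a n) ∧ (∀ t : ℝ, Summable fun n : ℕ => a n * t ^ n) ∧
          HasDotProductExpansion K a) ∧
    (∀ a : ℕ → ℝ, (∀ n, 0 ≤ a n) → (∀ t : ℝ, Summable fun n : ℕ => a n * t ^ n) →
        ∃ K : EllTwo → EllTwo → ℂ, HasDotProductExpansion K a ∧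
          IsDotProductFunction K ∧ Continuous (Function.uncurry K) ∧ IsPosDefKernel K) ∧
    (∀ (K : EllTwo → EllTwo → ℂ) (a : ℕ → ℝ),
      IsPosDefKernel K → HasDotProductExpansion K a →
        (IsStrictlyPosDefKernel K ↔
          0 < a 0 ∧ {n : ℕ | Even n ∧ 0 < a n}.Infinite ∧ {n : ℕ | Odd n ∧ 0 < a n}.Infinite) ∧
        (IsStrictlyPosDefKernel (fun x y : {x : EllTwo // x ≠ 0} => K x.1 y.1) ↔
          {n : ℕ | Even n ∧ 0 < a n}.Infinite ∧ {n : ℕ | Odd n ∧ 0 < a n}.Infinite)) := by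
  obtain ⟨hseries, hkernel, hstrict⟩ := mainTheorem5_general not_finiteDimensional_ellTwo
  exact ⟨fun K hκ _ hK => hseries K hκ hK, hkernel, hstrict⟩
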